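/- Let $\mathcal H=\mathbb C^d$ with $d\ge 1$, and let $\mathscr A=\{A_j\}_j$ be a (discrete) POVM on $\mathcal H$, that is, a family of positive semidefinite operators with $\sum_j A_j=1$. Suppose $\mathscr A$ is simple, meaning that its elements are pairwise linearly independent. For a POVM $\mathscr B=\{B_k\}_k$ on $\mathcal H^{\otimes N}$, let the estimation fidelity be $$F(\mathscr B)=\max_{\{\hat\rho_k\}_k}\ \sum_k\int \operatorname{tr}\bigl(\rho^{\otimes N}B_k\bigr)\,\operatorname{tr}\bigl(\rho\,\hat\rho_k\bigr)\,d\mu(\psi),\qquad \rho=|\psi\rangle\langle\psi|,$$ where $\mu$ is the unitarily invariant (Haar) probability measure on pure states of $\mathcal H$ and the maximum is over all choices of density operators $\hat\rho_k$ on $\mathcal H$. Let $\mathscr A^{\otimes 2}=\{A_j\otimes A_k\}_{j,k}$. Then $\mathscr A$ is a rank-1 projective measurement (all the $A_j$ are mutually orthogonal rank-1 projectors) if and only if $$F(\mathscr A^{\otimes 2})=F(\mathscr A)=\frac{2}{d+1}.$$ -/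

import Mathlib

open MeasureTheory
open scoped Kronecker ComplexOrder

/-- A discrete POVM with (possibly infinite) outcome set `ι` on the Hilbert space `ℂ^κ`: a family of
positive semidefinite operators that sum up to the identity. For a finite outcome set `HasSum` is
the ordinary finite sum. -/
structure POVM (ι : Type*) (κ : Type*) [Fintype κ] [DecidableEq κ] where
  /-- The POVM elements. -/
  elem : ι → Matrix κ κ ℂ
  posSemidef : ∀ j, (elem j).PosSemidef
  hasSum_one : HasSum elem 1

namespace POVM

variable {ι ι' κ κ' : Type*} [Fintype κ] [DecidableEq κ] [Fintype κ'] [DecidableEq κ']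

/-- The POVM elements are pairwise linearly independent. -/
def IsSimple (A : POVM ι κ) : Prop :=
  Pairwise fun j k => LinearIndependent ℂ ![A.elem j, A.elem k]

/-- All POVM elements are mutually orthogonal rank-1 (orthogonal) projectors. -/
def IsRankOneProjective (A : POVM ι κ) : Prop :=
  (∀ j, IsStarProjection (A.elem j) ∧ (A.elem j).rank = 1) ∧
    Pairwise fun j k => A.elem j * A.elem k = 0

theorem hasSum_mul_complex {f : ι → ℂ} {g : ι' → ℂ} {a b : ℂ} (hf : HasSum f a)
    (hg : HasSum g b) : HasSum (fun p : ι × ι' => f p.1 * g p.2) (a * b) :=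
  hf.mul hg (summable_mul_of_summable_norm (f := f) (g := g) hf.summable.norm hg.summable.norm)

theorem hasSum_kronecker {f : ι → Matrix κ κ ℂ} {g : ι' → Matrix κ' κ' ℂ}
    (hf : HasSum f 1) (hg : HasSum g 1) :
    HasSum (fun p : ι × ι' => f p.1 ⊗ₖ g p.2) (1 : Matrix (κ × κ') (κ × κ') ℂ) := by
  rw [← Matrix.one_kronecker_one]
  exact Pi.hasSum.2 fun x => Pi.hasSum.2 fun y => hasSum_mul_complex
    (f := fun j => f j x.1 y.1) (g := fun j => g j x.2 y.2)
    (Pi.hasSum.1 (Pi.hasSum.1 hf x.1) y.1) (Pi.hasSum.1 (Pi.hasSum.1 hg x.2) y.2)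

/-- The product POVM `A ⊗ B`, with elements `A_j ⊗ B_k`. -/
def tensor (A : POVM ι κ) (B : POVM ι' κ') : POVM (ι × ι') (κ × κ') where
  elem p := A.elem p.1 ⊗ₖ B.elem p.2
  posSemidef p := (A.posSemidef p.1).kronecker (B.posSemidef p.2)
  hasSum_one := hasSum_kronecker A.hasSum_one B.hasSum_one

end POVM

/-- Quantum states (density operators) on `ℂ^d`. -/
def DensityMatrix (d : ℕ) : Type :=
  {σ : Matrix (Fin d) (Fin d) ℂ // σ.PosSemidef ∧ σ.trace = 1}

/-- Unit vectors of `ℂ^d`. -/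
abbrev StateVector (d : ℕ) : Type :=
  Metric.sphere (0 : EuclideanSpace ℂ (Fin d)) 1

/-- The pure state `|ψ⟩⟨ψ|`. -/
def pureState {d : ℕ} (ψ : StateVector d) : Matrix (Fin d) (Fin d) ℂ :=
  Matrix.vecMulVec (fun i => ψ.1 i) (fun i => star (ψ.1 i))

/-- The distribution of a Haar random state vector: the normalized surface measure of the unit
sphere of `ℂ^d`, that is, the unitarily invariant probability measure on it. -/
noncomputable def haarState (d : ℕ) : Measure (StateVector d) :=
  ((volume : Measure (EuclideanSpace ℂ (Fin d))).toSphere Set.univ)⁻¹ •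
    (volume : Measure (EuclideanSpace ℂ (Fin d))).toSphere

namespace POVM

variable {ι κ : Type*} [Fintype κ] [DecidableEq κ] {d : ℕ}

/-- The average fidelity achieved with the estimators `est j`, when `ρ` is a Haar random pure state
and the POVM is performed on the state `copies ρ` (such as `ρ` or `ρ ⊗ ρ`): the sum over `j` of the
integrals of `p_j * tr (ρ * est j)`, where `p_j = tr (copies ρ * A_j)`. -/
noncomputable def averageFidelity (copies : Matrix (Fin d) (Fin d) ℂ → Matrix κ κ ℂ)
    (A : POVM ι κ) (est : ι → DensityMatrix d) : ℝ :=
  ∑' j, ∫ ψ, (copies (pureState ψ) * A.elem j).trace.re *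
    (pureState ψ * (est j).1).trace.re ∂(haarState d)

/-- The maximum average fidelity over all choices of the estimators. -/
noncomputable def estimationFidelity (copies : Matrix (Fin d) (Fin d) ℂ → Matrix κ κ ℂ)
    (A : POVM ι κ) : ℝ :=
  ⨆ est : ι → DensityMatrix d, A.averageFidelity copies est

/-- The one-copy estimation fidelity `F(A)` of a POVM on `ℂ^d`. -/
noncomputable def fidelityOneCopy (A : POVM ι (Fin d)) : ℝ :=
  A.estimationFidelity fun ρ => ρ

/-- The two-copy estimation fidelity `F(A)` of a POVM on `ℂ^d ⊗ ℂ^d`. -/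
noncomputable def fidelityTwoCopy (A : POVM ι (Fin d × Fin d)) : ℝ :=
  A.estimationFidelity fun ρ => ρ ⊗ₖ ρ

end POVM

/-! The third Haar moment `∫ ⟨ψ, Aψ⟩⟨ψ, Bψ⟩⟨ψ, Cψ⟩ dμ` turns each fidelity into a sum over outcomes
of the largest expectation value of an operator attached to the outcome: an affine function of `A_j`
for one copy, and a symmetric expression in `A_j` and `A_k` for two. The one-copy fidelity is
`2 / (d + 1)` iff every element is a nonnegative multiple of a pure state `ψ_j`. Answering `ψ_j` to
the outcome `(j, k)` of the product measurement already achieves `2 / (d + 1)`, so the two-copy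
fidelity equals this value iff `ψ_j` is always optimal, that is, a top eigenvector of the two-copy
operator. This forces `ψ_j` and `ψ_k` to be orthogonal or parallel, and simplicity excludes the
latter for `j ≠ k`. -/

open Matrix

section GaussianMoments

variable {ι : Type*} [Fintype ι]

theorem integral_norm_pow_mul_exp_neg_norm_sq (n : ℕ) :
    ∫ z : ℂ, ‖z‖ ^ (2 * n) * Real.exp (-‖z‖ ^ 2) = Real.pi * n.factorial := by
  have h := Complex.integral_rpow_mul_exp_neg_rpow (p := 2) (q := ((2 * n : ℕ) : ℝ))
    (by norm_num) (by linarith [(2 * n : ℕ).cast_nonneg (α := ℝ)])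
  have hq : (((2 * n : ℕ) : ℝ) + 2) / 2 = n + 1 := by push_cast; ring
  simp only [hq, Real.Gamma_nat_eq_factorial, Real.rpow_natCast, Real.rpow_two] at h
  rw [h]
  ring

theorem integral_prod_norm_pow_mul_exp_neg_norm_sq (n : ι → ℕ) :
    ∫ x : ι → ℂ, ∏ l, ‖x l‖ ^ (2 * n l) * Real.exp (-‖x l‖ ^ 2) =
      Real.pi ^ Fintype.card ι * ∏ l, ((n l).factorial : ℝ) := by
  rw [volume_pi, integral_fintype_prod_eq_prod
    (f := fun l (z : ℂ) => ‖z‖ ^ (2 * n l) * Real.exp (-‖z‖ ^ 2))]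
  simp only [integral_norm_pow_mul_exp_neg_norm_sq, Finset.prod_mul_distrib, Finset.prod_const,
    Finset.card_univ]

theorem prod_factorial_add_single [DecidableEq ι] (n : ι → ℕ) (k : ι) :
    ∏ l, ((n + Pi.single k 1 : ι → ℕ) l).factorial = (n k + 1) * ∏ l, (n l).factorial := by
  have h : ∀ l, ((n + Pi.single k 1 : ι → ℕ) l).factorial =
      (if l = k then n k + 1 else 1) * (n l).factorial := fun l => by
    rcases eq_or_ne l k with rfl | hl
    · simp [Nat.factorial_succ]
    · simp [hl]
  simp only [h, Finset.prod_mul_distrib, Finset.prod_ite_eq', Finset.mem_univ, if_true]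

theorem prod_norm_pow_single_mul_exp [DecidableEq ι] (i j k : ι) (x : ι → ℂ) :
    ∏ l, ‖x l‖ ^ (2 * (0 + Pi.single i 1 + Pi.single j 1 + Pi.single k 1 : ι → ℕ) l) *
      Real.exp (-‖x l‖ ^ 2) =
      ‖x i‖ ^ 2 * ‖x j‖ ^ 2 * ‖x k‖ ^ 2 * Real.exp (-∑ l, ‖x l‖ ^ 2) := by
  have h : ∀ m : ι, ∏ l, ‖x l‖ ^ (2 * (Pi.single m 1 : ι → ℕ) l) = ‖x m‖ ^ 2 := fun m => by
    rw [Finset.prod_eq_single m] <;> simp +contextual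
  simp only [Pi.add_apply, zero_add, mul_add, pow_add, Finset.prod_mul_distrib, h, ← Real.exp_sum,
    Finset.sum_neg_distrib]

theorem integral_norm_sq_mul_mul_mul_exp [DecidableEq ι] (i j k : ι) :
    ∫ x : ι → ℂ, ‖x i‖ ^ 2 * ‖x j‖ ^ 2 * ‖x k‖ ^ 2 * Real.exp (-∑ l, ‖x l‖ ^ 2) =
      Real.pi ^ Fintype.card ι *
        ((1 + if i = j then 1 else 0) *
          (1 + (if i = k then 1 else 0) + if j = k then 1 else 0)) := by
  simp_rw [← prod_norm_pow_single_mul_exp i j k, integral_prod_norm_pow_mul_exp_neg_norm_sq,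
    ← Nat.cast_prod, prod_factorial_add_single]
  simp only [Pi.add_apply, Pi.zero_apply, Pi.single_apply, Nat.factorial_zero,
    Finset.prod_const_one, eq_comm (a := k), eq_comm (a := j) (b := i)]
  push_cast
  ring

theorem integrable_norm_sq_mul_mul_mul_exp (i j k : ι) :
    Integrable fun x : ι → ℂ =>
      ‖x i‖ ^ 2 * ‖x j‖ ^ 2 * ‖x k‖ ^ 2 * Real.exp (-∑ l, ‖x l‖ ^ 2) := by
  classical
  refine Integrable.of_integral_ne_zero ?_
  rw [integral_norm_sq_mul_mul_mul_exp]
  positivity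

theorem sum_mul_mul_mul_eq_powerSums [DecidableEq ι] (w : ι → ℝ) :
    ∑ i, ∑ j, ∑ k, w i * w j * w k *
        ((1 + if i = j then 1 else 0) * (1 + (if i = k then 1 else 0) + if j = k then 1 else 0)) =
      (∑ i, w i) ^ 3 + 3 * (∑ i, w i) * (∑ i, w i ^ 2) + 2 * ∑ i, w i ^ 3 := by
  set s := ∑ i, w i with hs
  have sum_k : ∀ i j, ∑ k, w i * w j * w k *
      ((1 + if i = j then 1 else 0) * (1 + (if i = k then 1 else 0) + if j = k then 1 else 0)) =
      w i * w j * (s + w i + w j) * (1 + if i = j then 1 else 0) := fun i j => by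
    simp only [mul_comm _ (1 + ite (i = j) (1 : ℝ) 0), ← Finset.mul_sum, mul_add, mul_one,
      mul_ite, mul_zero, Finset.sum_add_distrib,
      Finset.sum_ite_eq, Finset.mem_univ, if_true, ← hs]
  have sum_j : ∀ i, ∑ j, w i * w j * (s + w i + w j) * (1 + if i = j then 1 else 0) =
      (s ^ 2 + ∑ j, w j ^ 2) * w i + 2 * s * w i ^ 2 + 2 * w i ^ 3 := fun i => by
    have expand : ∀ j, w i * w j * (s + w i + w j) * (1 + if i = j then 1 else 0) =
        w i * (s + w i) * w j + w i * w j ^ 2 +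
          if i = j then w i * w j * (s + w i + w j) else 0 := fun j => by
      split_ifs <;> ring
    simp only [expand, Finset.sum_add_distrib, ← Finset.mul_sum, Finset.sum_ite_eq,
      Finset.mem_univ, if_true, ← hs]
    ring
  simp only [sum_k, sum_j, Finset.sum_add_distrib, ← Finset.mul_sum, ← hs]
  ring

theorem integral_sum_cube_mul_exp (w : ι → ℝ) :
    ∫ x : ι → ℂ, (∑ i, w i * ‖x i‖ ^ 2) ^ 3 * Real.exp (-∑ i, ‖x i‖ ^ 2) =
      Real.pi ^ Fintype.card ι *
        ((∑ i, w i) ^ 3 + 3 * (∑ i, w i) * (∑ i, w i ^ 2) + 2 * ∑ i, w i ^ 3) := by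
  classical
  have expand : ∀ x : ι → ℂ, (∑ i, w i * ‖x i‖ ^ 2) ^ 3 * Real.exp (-∑ i, ‖x i‖ ^ 2) =
      ∑ i, ∑ j, ∑ k, w i * w j * w k *
        (‖x i‖ ^ 2 * ‖x j‖ ^ 2 * ‖x k‖ ^ 2 * Real.exp (-∑ l, ‖x l‖ ^ 2)) := fun x => by
    rw [pow_three', Finset.sum_mul_sum, Finset.sum_mul]
    simp only [Finset.sum_mul_sum]
    simp only [Finset.sum_mul]
    exact Finset.sum_congr rfl fun i _ => Finset.sum_congr rfl fun j _ =>
      Finset.sum_congr rfl fun k _ => by ring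
  have hint : ∀ i j k, Integrable fun x : ι → ℂ => w i * w j * w k *
      (‖x i‖ ^ 2 * ‖x j‖ ^ 2 * ‖x k‖ ^ 2 * Real.exp (-∑ l, ‖x l‖ ^ 2)) :=
    fun i j k => (integrable_norm_sq_mul_mul_mul_exp i j k).const_mul _
  simp_rw [expand]
  rw [integral_finsetSum _ fun i _ => integrable_finsetSum _ fun j _ =>
    integrable_finsetSum _ fun k _ => hint i j k]
  simp_rw [integral_finsetSum _ fun j _ => integrable_finsetSum _ fun k _ => hint _ j k,
    integral_finsetSum _ fun k _ => hint _ _ k, integral_const_mul,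
    integral_norm_sq_mul_mul_mul_exp, mul_left_comm _ (Real.pi ^ Fintype.card ι), ← Finset.mul_sum]
  rw [sum_mul_mul_mul_eq_powerSums]

end GaussianMoments

theorem integral_homogeneous_mul_exp_neg_norm_sq {E : Type*} [NormedAddCommGroup E]
    [NormedSpace ℝ E] [MeasurableSpace E] [BorelSpace E] [FiniteDimensional ℝ E] [Nontrivial E]
    (μ : Measure E) [μ.IsAddHaarMeasure] (m : ℕ) :
    ∃ K : ℝ, ∀ f : E → ℝ, (∀ (r : ℝ) (x : E), f (r • x) = r ^ m * f x) →
      ∫ x, f x * Real.exp (-‖x‖ ^ 2) ∂μ = K * ∫ x, f x.1 ∂μ.toSphere := by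
  refine ⟨∫ r, r.1 ^ m * Real.exp (-r.1 ^ 2) ∂(Measure.volumeIoiPow (Module.finrank ℝ E - 1)),
    fun f hf => ?_⟩
  rw [mul_comm, ← integral_prod_mul (f := fun x : Metric.sphere (0 : E) 1 => f x.1)
    (g := fun r : Set.Ioi (0 : ℝ) => r.1 ^ m * Real.exp (-r.1 ^ 2)),
    ← μ.measurePreserving_homeomorphUnitSphereProd.integral_comp
      (Homeomorph.measurableEmbedding _)]
  conv_lhs => rw [← restrict_compl_singleton (μ := μ) (0 : E),
    ← integral_subtype_comap (measurableSet_singleton _).compl]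
  congr with x
  have hx : x.1 = ‖x.1‖ • ‖x.1‖⁻¹ • x.1 := by
    rw [smul_smul, mul_inv_cancel₀ (norm_ne_zero_iff.2 x.2), one_smul]
  have hfx : f x.1 = ‖x.1‖ ^ m * f (‖x.1‖⁻¹ • x.1) := by rw [← hf, ← hx]
  simp only [homeomorphUnitSphereProd_apply_fst_coe, homeomorphUnitSphereProd_apply_snd_coe, hfx]
  ring

theorem exists_integral_euclideanSpace_eq (n : Type*) [Fintype n] :
    ∃ c : ℝ, 0 < c ∧ ∀ f : EuclideanSpace ℂ n → ℝ,
      ∫ x, f x = c * ∫ x : n → ℂ, f (WithLp.toLp 2 x) := by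
  let e : (n → ℂ) ≃L[ℝ] EuclideanSpace ℂ n :=
    (PiLp.continuousLinearEquiv 2 ℝ (fun _ : n => ℂ)).symm
  let ν : Measure (EuclideanSpace ℂ n) := Measure.map e (volume : Measure (n → ℂ))
  have : ν.IsAddHaarMeasure := e.isAddHaarMeasure_map volume
  refine ⟨(volume : Measure (EuclideanSpace ℂ n)).addHaarScalarFactor ν,
    NNReal.coe_pos.2 (Measure.addHaarScalarFactor_pos_of_isAddHaarMeasure _ _), fun f => ?_⟩
  conv_lhs => rw [Measure.isAddLeftInvariant_eq_smul volume ν]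
  rw [integral_smul_nnreal_measure,
    MeasurableEmbedding.integral_map (f := e) e.toHomeomorph.measurableEmbedding]
  rfl

section Expectation

variable {n : Type*} [Fintype n]

/-- The expectation value `⟨x|A|x⟩` of an observable `A`; only its real part is recorded, which is
all of it when `A` is Hermitian. -/
noncomputable def expectation (A : Matrix n n ℂ) (x : EuclideanSpace ℂ n) : ℝ :=
  (star x.ofLp ⬝ᵥ A *ᵥ x.ofLp).re

theorem expectation_add (A B : Matrix n n ℂ) (x : EuclideanSpace ℂ n) :
    expectation (A + B) x = expectation A x + expectation B x := by
  simp only [expectation, add_mulVec, dotProduct_add, Complex.add_re]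

theorem expectation_sub (A B : Matrix n n ℂ) (x : EuclideanSpace ℂ n) :
    expectation (A - B) x = expectation A x - expectation B x := by
  simp only [expectation, sub_mulVec, dotProduct_sub, Complex.sub_re]

theorem expectation_smul (c : ℝ) (A : Matrix n n ℂ) (x : EuclideanSpace ℂ n) :
    expectation (c • A) x = c * expectation A x := by
  simp only [expectation, smul_mulVec, dotProduct_smul, Complex.smul_re, smul_eq_mul]

theorem expectation_smul_vec (A : Matrix n n ℂ) (r : ℝ) (x : EuclideanSpace ℂ n) :
    expectation A (r • x) = r ^ 2 * expectation A x := by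
  simp only [expectation, WithLp.ofLp_smul, star_smul, star_trivial, mulVec_smul, smul_dotProduct,
    dotProduct_smul, Complex.smul_re, smul_eq_mul]
  ring

theorem expectation_one [DecidableEq n] (x : EuclideanSpace ℂ n) : expectation 1 x = ‖x‖ ^ 2 := by
  rw [expectation, one_mulVec, dotProduct_comm, ← EuclideanSpace.inner_eq_star_dotProduct,
    inner_self_eq_norm_sq_to_K]
  norm_cast

theorem continuous_expectation (A : Matrix n n ℂ) : Continuous (expectation A) := by
  unfold expectation
  fun_prop

theorem expectation_eq_sum_eigenvalues [DecidableEq n] {A : Matrix n n ℂ} (hA : A.IsHermitian)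
    (x : EuclideanSpace ℂ n) :
    expectation A x = ∑ i, hA.eigenvalues i * ‖hA.eigenvectorBasis.repr x i‖ ^ 2 := by
  have hU : ∀ i, (star hA.eigenvectorUnitary.1 *ᵥ x.ofLp) i = hA.eigenvectorBasis.repr x i := by
    intro i
    rw [OrthonormalBasis.repr_apply_apply, EuclideanSpace.inner_eq_star_dotProduct,
      dotProduct_comm]
    rfl
  have hsp : A = hA.eigenvectorUnitary.1 * diagonal (RCLike.ofReal ∘ hA.eigenvalues) *
      star hA.eigenvectorUnitary.1 :=
    hA.spectral_theorem.trans (Unitary.conjStarAlgAut_apply _ _)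
  have hz : star x.ofLp ᵥ* hA.eigenvectorUnitary.1 =
      star (star hA.eigenvectorUnitary.1 *ᵥ x.ofLp) := by
    rw [star_mulVec, star_eq_conjTranspose, conjTranspose_conjTranspose]
  rw [expectation]
  conv_lhs => rw [hsp]
  rw [← mulVec_mulVec, ← mulVec_mulVec, dotProduct_mulVec, hz, dotProduct, Complex.re_sum]
  refine Finset.sum_congr rfl fun i _ => ?_
  rw [mulVec_diagonal, Pi.star_apply, hU, mul_left_comm, RCLike.star_def, RCLike.conj_mul,
    Function.comp_apply, RCLike.ofReal_eq_complex_ofReal]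
  norm_cast

theorem trace_pow_eq_sum_eigenvalues [DecidableEq n] {A : Matrix n n ℂ} (hA : A.IsHermitian)
    (k : ℕ) : (A ^ k).trace = ((∑ i, hA.eigenvalues i ^ k : ℝ) : ℂ) := by
  conv_lhs => rw [hA.spectral_theorem, ← map_pow, Unitary.conjStarAlgAut_apply,
    diagonal_pow, trace_mul_comm, ← mul_assoc, Unitary.coe_star_mul_self, one_mul]
  simp only [trace_diagonal, Pi.pow_apply, Function.comp_apply, Complex.coe_algebraMap]
  push_cast
  rfl

end Expectation

section HaarMoments

variable {d : ℕ}

/-- `(N + 1)!` times the partial trace over the first `N = 1` tensor factor of `P (A ⊗ 1)`, where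
`P` projects onto the symmetric subspace; its expectation values are, up to
normalization, the fidelities of the pure estimates on an outcome with POVM element `A`. -/
def oneCopyOperator (A : Matrix (Fin d) (Fin d) ℂ) : Matrix (Fin d) (Fin d) ℂ :=
  A.trace • 1 + A

/-- `(N + 1)!` times the partial trace over the first `N = 2` tensor factors of `P (A ⊗ B ⊗ 1)`,
where `P` projects onto the symmetric subspace; its expectation values are, up to
normalization, the fidelities of the pure estimates on an outcome with POVM element `A ⊗ B`. -/
def twoCopyOperator (A B : Matrix (Fin d) (Fin d) ℂ) : Matrix (Fin d) (Fin d) ℂ :=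
  (A.trace * B.trace + (A * B).trace) • 1 + B.trace • A + A.trace • B + A * B + B * A

theorem twoCopyOperator_one (A : Matrix (Fin d) (Fin d) ℂ) :
    twoCopyOperator A 1 = (d + 2) • oneCopyOperator A := by
  simp only [twoCopyOperator, oneCopyOperator, trace_one, Fintype.card_fin, mul_one, one_mul]
  module

theorem trace_twoCopyOperator_mul (A B C : Matrix (Fin d) (Fin d) ℂ) :
    (twoCopyOperator A B * C).trace = A.trace * B.trace * C.trace + (A * B).trace * C.trace +
      (A * C).trace * B.trace + (B * C).trace * A.trace + (A * B * C).trace +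
      (B * A * C).trace := by
  simp only [twoCopyOperator, add_mul, smul_mul_assoc, one_mul, trace_add, trace_smul, smul_eq_mul]
  ring

theorem twoCopyOperator_comm (A B : Matrix (Fin d) (Fin d) ℂ) :
    twoCopyOperator A B = twoCopyOperator B A := by
  rw [twoCopyOperator, twoCopyOperator, trace_mul_comm A B, mul_comm A.trace]
  abel

theorem twoCopyOperator_add (A B C : Matrix (Fin d) (Fin d) ℂ) :
    twoCopyOperator A (B + C) = twoCopyOperator A B + twoCopyOperator A C := by
  simp only [twoCopyOperator, mul_add, add_mul, trace_add]
  module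

theorem trace_twoCopyOperator_mul_right_comm (A B C : Matrix (Fin d) (Fin d) ℂ) :
    (twoCopyOperator A B * C).trace = (twoCopyOperator A C * B).trace := by
  rw [trace_twoCopyOperator_mul, trace_twoCopyOperator_mul, trace_mul_cycle A B C,
    trace_mul_cycle B A C, trace_mul_cycle C B A, trace_mul_comm B C]
  ring

theorem trace_twoCopyOperator_mul_polarization (A B C : Matrix (Fin d) (Fin d) ℂ) :
    (twoCopyOperator (A + B + C) (A + B + C) * (A + B + C)).trace -
      (twoCopyOperator (A + B) (A + B) * (A + B)).trace -
      (twoCopyOperator (A + C) (A + C) * (A + C)).trace -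
      (twoCopyOperator (B + C) (B + C) * (B + C)).trace + (twoCopyOperator A A * A).trace +
      (twoCopyOperator B B * B).trace + (twoCopyOperator C C * C).trace =
      6 * (twoCopyOperator A B * C).trace := by
  have add_left : ∀ X Y Z : Matrix (Fin d) (Fin d) ℂ,
      twoCopyOperator (X + Y) Z = twoCopyOperator X Z + twoCopyOperator Y Z :=
    fun X Y Z => by simp only [twoCopyOperator_comm _ Z, twoCopyOperator_add]
  simp only [add_left, twoCopyOperator_add, mul_add, add_mul, trace_add]
  rw [twoCopyOperator_comm B A, twoCopyOperator_comm C A, twoCopyOperator_comm C B,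
    trace_twoCopyOperator_mul_right_comm A C B, twoCopyOperator_comm B C,
    trace_twoCopyOperator_mul_right_comm C B A, twoCopyOperator_comm C A,
    trace_twoCopyOperator_mul_right_comm A C B]
  ring

theorem trace_twoCopyOperator_self_mul_self {A : Matrix (Fin d) (Fin d) ℂ} (hA : A.IsHermitian) :
    (twoCopyOperator A A * A).trace.re = (∑ i, hA.eigenvalues i) ^ 3 +
      3 * (∑ i, hA.eigenvalues i) * (∑ i, hA.eigenvalues i ^ 2) +
      2 * ∑ i, hA.eigenvalues i ^ 3 := by
  have h1 := trace_pow_eq_sum_eigenvalues hA 1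
  simp only [pow_one] at h1
  rw [trace_twoCopyOperator_mul, ← pow_two A, ← pow_succ A, trace_pow_eq_sum_eigenvalues hA,
    trace_pow_eq_sum_eigenvalues hA, h1]
  norm_cast
  ring

theorem exists_integral_expectation_cube_mul_exp (d : ℕ) :
    ∃ c : ℝ, c ≠ 0 ∧ ∀ A : Matrix (Fin d) (Fin d) ℂ, A.IsHermitian →
      ∫ x, expectation A x ^ 3 * Real.exp (-‖x‖ ^ 2) = c * (twoCopyOperator A A * A).trace.re := by
  obtain ⟨c, hc0, hc⟩ := exists_integral_euclideanSpace_eq (Fin d)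
  refine ⟨c * Real.pi ^ d, by positivity, fun A hA => ?_⟩
  let b := hA.eigenvectorBasis
  let e : EuclideanSpace ℂ (Fin d) ≃ₗᵢ[ℝ] EuclideanSpace ℂ (Fin d) :=
    { b.repr.toLinearEquiv.restrictScalars ℝ with norm_map' := b.repr.norm_map }
  have diagonalize : ∫ x, expectation A x ^ 3 * Real.exp (-‖x‖ ^ 2) =
      ∫ x : EuclideanSpace ℂ (Fin d),
        (∑ i, hA.eigenvalues i * ‖x i‖ ^ 2) ^ 3 * Real.exp (-∑ i, ‖x i‖ ^ 2) := by
    rw [← e.measurePreserving.integral_comp e.toHomeomorph.measurableEmbedding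
      (fun x => (∑ i, hA.eigenvalues i * ‖x i‖ ^ 2) ^ 3 * Real.exp (-∑ i, ‖x i‖ ^ 2))]
    congr with x
    rw [expectation_eq_sum_eigenvalues hA, ← e.norm_map, EuclideanSpace.norm_sq_eq]
    rfl
  rw [diagonalize, hc, integral_sum_cube_mul_exp, trace_twoCopyOperator_self_mul_self hA,
    Fintype.card_fin]
  ring

theorem expectation_one_stateVector (ψ : StateVector d) : expectation 1 ψ.1 = 1 := by
  rw [expectation_one, mem_sphere_zero_iff_norm.1 ψ.2, one_pow]

variable [NeZero d]

instance : NeZero (volume : Measure (EuclideanSpace ℂ (Fin d))).toSphere :=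
  ⟨Measure.toSphere_ne_zero _⟩

instance : IsProbabilityMeasure (haarState d) :=
  isProbabilityMeasureSMul

theorem integral_toSphere_eq (f : StateVector d → ℝ) :
    ∫ ψ, f ψ ∂(volume : Measure (EuclideanSpace ℂ (Fin d))).toSphere =
      (volume : Measure (EuclideanSpace ℂ (Fin d))).toSphere.real Set.univ *
        ∫ ψ, f ψ ∂haarState d := by
  rw [haarState, integral_smul_measure, ENNReal.toReal_inv, smul_eq_mul]
  exact (mul_inv_cancel_left₀ measureReal_univ_ne_zero _).symm

theorem integral_expectation_cube {A : Matrix (Fin d) (Fin d) ℂ} (hA : A.IsHermitian) :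
    ∫ ψ, expectation A ψ.1 ^ 3 ∂haarState d =
      (twoCopyOperator A A * A).trace.re / (d * (d + 1) * (d + 2)) := by
  obtain ⟨c, hc0, hc⟩ := exists_integral_expectation_cube_mul_exp d
  obtain ⟨K, hK⟩ := integral_homogeneous_mul_exp_neg_norm_sq
    (volume : Measure (EuclideanSpace ℂ (Fin d))) 6
  have polar : ∀ B : Matrix (Fin d) (Fin d) ℂ, B.IsHermitian →
      c * (twoCopyOperator B B * B).trace.re =
        K * (volume : Measure (EuclideanSpace ℂ (Fin d))).toSphere.real Set.univ *
          ∫ ψ, expectation B ψ.1 ^ 3 ∂haarState d := fun B hB => by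
    rw [← hc B hB, hK (fun x => expectation B x ^ 3) fun r x => by
      rw [expectation_smul_vec]; ring, integral_toSphere_eq, mul_assoc]
  have normalization : (twoCopyOperator (1 : Matrix (Fin d) (Fin d) ℂ) 1 * 1).trace.re =
      (d : ℝ) * (d + 1) * (d + 2) := by
    rw [trace_twoCopyOperator_mul]
    simp only [mul_one, trace_one, Fintype.card_fin]
    norm_cast
    ring
  -- Evaluating at `A = 1` avoids computing the constants of integration.
  have hone := polar 1 isHermitian_one
  rw [normalization] at hone
  simp only [expectation_one_stateVector, one_pow, integral_const, probReal_univ,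
    smul_eq_mul, mul_one] at hone
  have hd : (d : ℝ) ≠ 0 := Nat.cast_ne_zero.2 (NeZero.ne d)
  rw [eq_div_iff (by positivity)]
  refine mul_left_cancel₀ hc0 ?_
  rw [polar A hA, ← hone]
  ring

theorem integrable_expectation_cube (A : Matrix (Fin d) (Fin d) ℂ) :
    Integrable (fun ψ : StateVector d => expectation A ψ.1 ^ 3) (haarState d) :=
  (((continuous_expectation A).comp continuous_subtype_val).pow 3).integrable_of_hasCompactSupport
    (HasCompactSupport.of_compactSpace _)

theorem integral_expectation_mul_mul {A B C : Matrix (Fin d) (Fin d) ℂ} (hA : A.IsHermitian)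
    (hB : B.IsHermitian) (hC : C.IsHermitian) :
    ∫ ψ, expectation A ψ.1 * expectation B ψ.1 * expectation C ψ.1 ∂haarState d =
      (twoCopyOperator A B * C).trace.re / (d * (d + 1) * (d + 2)) := by
  have polarization : ∀ a b c : ℝ, a * b * c = 6⁻¹ * ((a + b + c) ^ 3 - (a + b) ^ 3 -
      (a + c) ^ 3 - (b + c) ^ 3 + a ^ 3 + b ^ 3 + c ^ 3) := fun a b c => by ring
  have cube_integrable := integrable_expectation_cube (d := d)
  simp only [polarization, ← expectation_add]
  rw [integral_const_mul, integral_add, integral_add, integral_add, integral_sub, integral_sub,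
    integral_sub] <;> try fun_prop
  rw [integral_expectation_cube ((hA.add hB).add hC), integral_expectation_cube (hA.add hB),
    integral_expectation_cube (hA.add hC), integral_expectation_cube (hB.add hC),
    integral_expectation_cube hA, integral_expectation_cube hB, integral_expectation_cube hC]
  have h := congrArg Complex.re (trace_twoCopyOperator_mul_polarization A B C)
  simp only [Complex.add_re, Complex.sub_re, Complex.mul_re, Complex.re_ofNat, Complex.im_ofNat,
    zero_mul, sub_zero] at h
  linear_combination 6⁻¹ * (d * (d + 1) * (d + 2) : ℝ)⁻¹ * h

theorem integral_expectation_mul {A C : Matrix (Fin d) (Fin d) ℂ} (hA : A.IsHermitian)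
    (hC : C.IsHermitian) :
    ∫ ψ, expectation A ψ.1 * expectation C ψ.1 ∂haarState d =
      (oneCopyOperator A * C).trace.re / (d * (d + 1)) := by
  have h := integral_expectation_mul_mul hA isHermitian_one hC
  simp only [expectation_one_stateVector, mul_one, twoCopyOperator_one, smul_mul_assoc,
    trace_smul] at h
  rw [h, Complex.smul_re, nsmul_eq_mul]
  push_cast
  field_simp

end HaarMoments

theorem trace_eq_rank_of_isIdempotentElem {n : Type*} [Fintype n] {A : Matrix n n ℂ}
    (hA : IsIdempotentElem A) : A.trace = A.rank := by
  classical
  have hlin : IsIdempotentElem (toLin' A) := by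
    rw [IsIdempotentElem, Module.End.mul_eq_comp, ← toLin'_mul, hA.eq]
  have htrace := (LinearMap.IsIdempotentElem.isProj_range _ hlin).trace
  rwa [trace_toLin'_eq] at htrace

theorem posSemidef_of_isStarProjection {n : Type*} [Fintype n] {P : Matrix n n ℂ}
    (hP : IsStarProjection P) : P.PosSemidef := by
  have h := posSemidef_conjTranspose_mul_self P
  rwa [← star_eq_conjTranspose, hP.isSelfAdjoint.star_eq, hP.isIdempotentElem.eq] at h

section PureStates

variable {d : ℕ}

theorem trace_mul_vecMulVec_star {n : Type*} [Fintype n] (A : Matrix n n ℂ) (w : n → ℂ) :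
    (A * vecMulVec w (star w)).trace = star w ⬝ᵥ A *ᵥ w := by
  rw [mul_vecMulVec, trace_vecMulVec, dotProduct_comm]

theorem re_trace_mul_pureState (A : Matrix (Fin d) (Fin d) ℂ) (ψ : StateVector d) :
    (A * pureState ψ).trace.re = expectation A ψ.1 :=
  congrArg Complex.re (trace_mul_vecMulVec_star A _)

theorem star_dotProduct_stateVector (ψ : StateVector d) : star ψ.1.ofLp ⬝ᵥ ψ.1.ofLp = 1 := by
  rw [dotProduct_comm, ← EuclideanSpace.inner_eq_star_dotProduct, inner_self_eq_norm_sq_to_K,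
    mem_sphere_zero_iff_norm.1 ψ.2]
  norm_num

theorem trace_pureState (ψ : StateVector d) : (pureState ψ).trace = 1 :=
  (trace_vecMulVec _ _).trans ((dotProduct_comm _ _).trans (star_dotProduct_stateVector ψ))

theorem pureState_mul_mul_pureState (ψ : StateVector d) (A : Matrix (Fin d) (Fin d) ℂ) :
    pureState ψ * A * pureState ψ = (pureState ψ * A).trace • pureState ψ := by
  rw [trace_mul_comm]
  change vecMulVec ψ.1.ofLp (star ψ.1.ofLp) * A * vecMulVec ψ.1.ofLp (star ψ.1.ofLp) =
    (A * vecMulVec ψ.1.ofLp (star ψ.1.ofLp)).trace • vecMulVec ψ.1.ofLp (star ψ.1.ofLp)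
  rw [trace_mul_vecMulVec_star, mul_assoc, mul_vecMulVec, vecMulVec_mul_vecMulVec,
    vecMulVec_smul', op_smul_eq_smul, smul_vecMulVec]

theorem posSemidef_pureState (ψ : StateVector d) : (pureState ψ).PosSemidef :=
  posSemidef_vecMulVec_self_star ψ.1.ofLp

theorem isStarProjection_pureState (ψ : StateVector d) : IsStarProjection (pureState ψ) where
  isIdempotentElem := by
    simpa only [mul_one, trace_pureState, one_smul, IsIdempotentElem] using
      pureState_mul_mul_pureState ψ 1
  isSelfAdjoint := (posSemidef_pureState ψ).1

theorem expectation_pureState_self (ψ : StateVector d) : expectation (pureState ψ) ψ.1 = 1 := by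
  rw [← re_trace_mul_pureState, (isStarProjection_pureState ψ).isIdempotentElem.eq,
    trace_pureState, Complex.one_re]

theorem eq_one_of_isIdempotentElem_smul_pureState {a : ℝ} {ψ : StateVector d}
    (h : IsIdempotentElem (a • pureState ψ)) (hne : a • pureState ψ ≠ 0) : a = 1 := by
  have htrace : a * a = a := by
    simpa [IsIdempotentElem, (isStarProjection_pureState ψ).isIdempotentElem.eq, trace_smul,
      trace_pureState] using congrArg (fun M => M.trace.re) h.eq
  exact (mul_eq_left₀ (left_ne_zero_of_smul hne)).1 htrace

theorem rank_pureState (ψ : StateVector d) : (pureState ψ).rank = 1 := by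
  have htrace := trace_eq_rank_of_isIdempotentElem (isStarProjection_pureState ψ).isIdempotentElem
  rw [trace_pureState] at htrace
  exact_mod_cast htrace.symm

theorem posSemidef_iff_expectation_nonneg {Q : Matrix (Fin d) (Fin d) ℂ} (hQ : Q.IsHermitian) :
    Q.PosSemidef ↔ ∀ ψ : StateVector d, 0 ≤ expectation Q ψ.1 := by
  refine ⟨fun h ψ => (Complex.nonneg_iff.1 (h.dotProduct_mulVec_nonneg _)).1, fun h =>
    .of_dotProduct_mulVec_nonneg hQ fun v => Complex.nonneg_iff.2
      ⟨?_, (hQ.im_star_dotProduct_mulVec_self v).symm⟩⟩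
  change 0 ≤ expectation Q (WithLp.toLp 2 v)
  set x : EuclideanSpace ℂ (Fin d) := WithLp.toLp 2 v
  rcases eq_or_ne x 0 with hx | hx
  · simp [hx, expectation]
  · have hx' : ‖x‖ ≠ 0 := norm_ne_zero_iff.2 hx
    have hunit : ‖x‖⁻¹ • x ∈ Metric.sphere (0 : EuclideanSpace ℂ (Fin d)) 1 := by
      rw [mem_sphere_zero_iff_norm, norm_smul, norm_inv, norm_norm, inv_mul_cancel₀ hx']
    rw [← one_smul ℝ x, ← mul_inv_cancel₀ hx', mul_smul, expectation_smul_vec]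
    exact mul_nonneg (sq_nonneg _) (h ⟨_, hunit⟩)

theorem posSemidef_smul_one_sub_iff {Q : Matrix (Fin d) (Fin d) ℂ} (hQ : Q.IsHermitian) {c : ℝ} :
    (c • 1 - Q).PosSemidef ↔ ∀ ψ : StateVector d, expectation Q ψ.1 ≤ c := by
  rw [posSemidef_iff_expectation_nonneg ((isHermitian_one.smul (.all c)).sub hQ)]
  simp only [expectation_sub, expectation_smul, expectation_one_stateVector, mul_one, sub_nonneg]

theorem expectation_le_one_of_isStarProjection {P : Matrix (Fin d) (Fin d) ℂ}
    (hP : IsStarProjection P) (ψ : StateVector d) : expectation P ψ.1 ≤ 1 := by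
  refine (posSemidef_smul_one_sub_iff hP.isSelfAdjoint).1 ?_ ψ
  rw [one_smul]
  exact posSemidef_of_isStarProjection hP.one_sub

theorem re_trace_mul_nonneg {n : Type*} [Fintype n] {A B : Matrix n n ℂ} (hA : A.PosSemidef)
    (hB : B.PosSemidef) : 0 ≤ (A * B).trace.re := by
  obtain ⟨m, v, rfl⟩ := posSemidef_iff_eq_sum_vecMulVec.1 hB
  rw [Finset.mul_sum, trace_sum, Complex.re_sum]
  refine Finset.sum_nonneg fun i _ => ?_
  rw [trace_mul_vecMulVec_star]
  exact (Complex.nonneg_iff.1 (hA.dotProduct_mulVec_nonneg _)).1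

theorem exists_forall_expectation_le [NeZero d] (Q : Matrix (Fin d) (Fin d) ℂ) :
    ∃ ψ : StateVector d, ∀ χ : StateVector d, expectation Q χ.1 ≤ expectation Q ψ.1 := by
  obtain ⟨x, hx, hmax⟩ := (isCompact_sphere (0 : EuclideanSpace ℂ (Fin d)) 1).exists_isMaxOn
    (NormedSpace.sphere_nonempty.2 zero_le_one) (continuous_expectation Q).continuousOn
  exact ⟨⟨x, hx⟩, fun χ => hmax χ.2⟩

theorem mul_pureState_of_forall_expectation_le {Q : Matrix (Fin d) (Fin d) ℂ}
    (hQ : Q.IsHermitian) {ψ : StateVector d}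
    (hψ : ∀ χ : StateVector d, expectation Q χ.1 ≤ expectation Q ψ.1) :
    Q * pureState ψ = expectation Q ψ.1 • pureState ψ := by
  have hM := (posSemidef_smul_one_sub_iff hQ).2 hψ
  have hzero : expectation (expectation Q ψ.1 • 1 - Q) ψ.1 = 0 := by
    rw [expectation_sub, expectation_smul, expectation_one_stateVector, mul_one, sub_self]
  have hker : (expectation Q ψ.1 • 1 - Q) *ᵥ ψ.1.ofLp = 0 :=
    (hM.dotProduct_mulVec_zero_iff _).1 <|
      Complex.ext hzero (hM.1.im_star_dotProduct_mulVec_self _)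
  have hP : (expectation Q ψ.1 • 1 - Q) * pureState ψ = 0 := by
    change _ * vecMulVec ψ.1.ofLp (star ψ.1.ofLp) = 0
    rw [mul_vecMulVec, hker, zero_vecMulVec]
  rw [sub_mul, smul_mul_assoc, one_mul, sub_eq_zero] at hP
  exact hP.symm

theorem trace_one_sub_mul_mul_one_sub (A : Matrix (Fin d) (Fin d) ℂ) (ψ : StateVector d) :
    ((1 - pureState ψ) * A * (1 - pureState ψ)).trace.re = A.trace.re - expectation A ψ.1 := by
  rw [mul_assoc, trace_mul_comm, mul_assoc,
    (isStarProjection_pureState ψ).one_sub.isIdempotentElem.eq, mul_sub, mul_one, trace_sub,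
    Complex.sub_re, re_trace_mul_pureState]

theorem posSemidef_one_sub_mul_mul_one_sub {A : Matrix (Fin d) (Fin d) ℂ} (hA : A.PosSemidef)
    (ψ : StateVector d) : ((1 - pureState ψ) * A * (1 - pureState ψ)).PosSemidef := by
  have h := hA.mul_mul_conjTranspose_same (1 - pureState ψ)
  rwa [← star_eq_conjTranspose,
    (isStarProjection_pureState ψ).one_sub.isSelfAdjoint.star_eq] at h

theorem re_trace_nonneg {n : Type*} [Fintype n] {A : Matrix n n ℂ} (hA : A.PosSemidef) :
    0 ≤ A.trace.re :=
  (Complex.nonneg_iff.1 hA.trace_nonneg).1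

theorem expectation_le_re_trace {A : Matrix (Fin d) (Fin d) ℂ} (hA : A.PosSemidef)
    (ψ : StateVector d) : expectation A ψ.1 ≤ A.trace.re := by
  rw [← sub_nonneg, ← trace_one_sub_mul_mul_one_sub]
  exact re_trace_nonneg (posSemidef_one_sub_mul_mul_one_sub hA ψ)

theorem expectation_eq_re_trace_iff {A : Matrix (Fin d) (Fin d) ℂ} (hA : A.PosSemidef)
    (ψ : StateVector d) : expectation A ψ.1 = A.trace.re ↔ A = A.trace.re • pureState ψ := by
  refine ⟨fun h => ?_, fun h => ?_⟩
  · have hR := posSemidef_one_sub_mul_mul_one_sub hA ψ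
    have hzero : (1 - pureState ψ) * A * (1 - pureState ψ) = 0 := by
      rw [← hR.trace_eq_zero_iff]
      refine Complex.ext ?_ (Complex.nonneg_iff.1 hR.trace_nonneg).2.symm
      rw [trace_one_sub_mul_mul_one_sub, h, sub_self, Complex.zero_re]
    have hAP : A * pureState ψ = A.trace.re • pureState ψ := h ▸
      mul_pureState_of_forall_expectation_le hA.1 fun χ => h ▸ expectation_le_re_trace hA χ
    have hPA : pureState ψ * A = A.trace.re • pureState ψ := by
      simpa only [conjTranspose_mul, hA.1.eq, (posSemidef_pureState ψ).1.eq, conjTranspose_smul,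
        star_trivial] using congrArg conjTranspose hAP
    rwa [sub_mul, one_mul, hPA, mul_sub, mul_one, sub_mul, hAP, smul_mul_assoc,
      (isStarProjection_pureState ψ).isIdempotentElem.eq, sub_self, sub_zero, sub_eq_zero] at hzero
  · conv_lhs => rw [h]
    rw [expectation_smul, expectation_pureState_self, mul_one]

end PureStates

section CopyOperators

variable {d : ℕ} {A B : Matrix (Fin d) (Fin d) ℂ}

theorem posSemidef_oneCopyOperator (hA : A.PosSemidef) : (oneCopyOperator A).PosSemidef :=
  (PosSemidef.one.smul hA.trace_nonneg).add hA

theorem expectation_oneCopyOperator (A : Matrix (Fin d) (Fin d) ℂ) (ψ : StateVector d) :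
    expectation (oneCopyOperator A) ψ.1 = A.trace.re + expectation A ψ.1 := by
  rw [← re_trace_mul_pureState, oneCopyOperator, add_mul, smul_mul_assoc, one_mul, trace_add,
    trace_smul, trace_pureState, smul_eq_mul, mul_one, Complex.add_re, re_trace_mul_pureState]

theorem isHermitian_twoCopyOperator (hA : A.IsHermitian) (hB : B.IsHermitian) :
    (twoCopyOperator A B).IsHermitian := by
  simp only [IsHermitian, twoCopyOperator, conjTranspose_add, conjTranspose_smul,
    conjTranspose_mul, conjTranspose_one, star_add, star_mul', ← trace_conjTranspose, hA.eq,
    hB.eq, trace_mul_comm B A]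
  abel

theorem twoCopyOperator_smul_smul (a b : ℝ) (A B : Matrix (Fin d) (Fin d) ℂ) :
    twoCopyOperator (a • A) (b • B) = (a * b) • twoCopyOperator A B := by
  simp only [twoCopyOperator, trace_smul, smul_mul_assoc, mul_smul_comm, Complex.real_smul]
  module

theorem posSemidef_twoCopyOperator [NeZero d] (hA : A.PosSemidef) (hB : B.PosSemidef) :
    (twoCopyOperator A B).PosSemidef := by
  rw [posSemidef_iff_expectation_nonneg (isHermitian_twoCopyOperator hA.1 hB.1)]
  intro χ
  have hd : (d : ℝ) ≠ 0 := Nat.cast_ne_zero.2 (NeZero.ne d)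
  have moment := integral_expectation_mul_mul hA.1 hB.1 (posSemidef_pureState χ).1
  rw [eq_div_iff (by positivity), re_trace_mul_pureState] at moment
  rw [← moment]
  refine mul_nonneg (integral_nonneg fun ψ => ?_) (by positivity)
  exact mul_nonneg (mul_nonneg ((posSemidef_iff_expectation_nonneg hA.1).1 hA ψ)
    ((posSemidef_iff_expectation_nonneg hB.1).1 hB ψ))
    ((posSemidef_iff_expectation_nonneg (posSemidef_pureState χ).1).1 (posSemidef_pureState χ) ψ)

theorem twoCopyOperator_pureState (ψ φ : StateVector d) :
    twoCopyOperator (pureState ψ) (pureState φ) =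
      (1 + (pureState ψ * pureState φ).trace) • 1 + pureState ψ + pureState φ +
        pureState ψ * pureState φ + pureState φ * pureState ψ := by
  simp only [twoCopyOperator, trace_pureState, mul_one, one_smul]

theorem expectation_twoCopyOperator_of_eq_smul_pureState {a : ℝ} {ψ : StateVector d}
    (hA : A = a • pureState ψ) (B : Matrix (Fin d) (Fin d) ℂ) :
    expectation (twoCopyOperator A B) ψ.1 =
      (2 * (A.trace * B.trace) + 4 * (A * B).trace).re := by
  have hsq := (isStarProjection_pureState ψ).isIdempotentElem.eq
  rw [← re_trace_mul_pureState, trace_twoCopyOperator_mul, hA, trace_mul_cycle]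
  simp only [trace_smul, smul_mul_assoc, mul_smul_comm, mul_assoc, hsq, trace_pureState,
    trace_mul_comm B, Complex.real_smul]
  ring_nf

theorem pureState_mul_eq_zero_or_eq_of_mul_eq_smul {ψ φ : StateVector d} {t : ℂ}
    (h : pureState φ * pureState ψ = t • pureState ψ) :
    pureState ψ * pureState φ = 0 ∨ pureState ψ = pureState φ := by
  have hadj : pureState ψ * pureState φ = star t • pureState ψ := by
    simpa only [conjTranspose_mul, conjTranspose_smul, (posSemidef_pureState _).1.eq] using
      congrArg conjTranspose h
  have htrace : (pureState φ * pureState ψ).trace = t := by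
    rw [h, trace_smul, trace_pureState, smul_eq_mul, mul_one]
  have hsmul : t • (star t • pureState ψ) = t • pureState φ := by
    rw [← hadj, ← smul_mul_assoc, ← h, pureState_mul_mul_pureState, htrace]
  rcases eq_or_ne t 0 with rfl | ht
  · left
    rw [hadj, star_zero, zero_smul]
  · right
    have hφ : star t • pureState ψ = pureState φ := smul_right_injective _ ht hsmul
    have hone : star t = 1 := by
      simpa only [trace_smul, trace_pureState, smul_eq_mul, mul_one] using congrArg trace hφ
    rwa [hone, one_smul] at hφ

theorem pureState_mul_eq_smul_of_twoCopyOperator_mul_eq_smul {ψ φ : StateVector d} {l : ℝ}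
    (h : twoCopyOperator (pureState ψ) (pureState φ) * pureState ψ = l • pureState ψ) :
    pureState φ * pureState ψ = (pureState ψ * pureState φ).trace • pureState ψ := by
  have hsq := (isStarProjection_pureState ψ).isIdempotentElem.eq
  have hPRP := pureState_mul_mul_pureState ψ (pureState φ)
  rw [twoCopyOperator_pureState] at h
  simp only [add_mul, smul_mul_assoc, one_mul, hsq, hPRP, mul_assoc (pureState φ)] at h
  have hleft := congrArg (pureState ψ * ·) h
  simp only [mul_add, mul_smul_comm, hsq, ← mul_assoc, hPRP] at hleft
  have htwo : (2 : ℂ) • (pureState φ * pureState ψ) =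
      (2 : ℂ) • ((pureState ψ * pureState φ).trace • pureState ψ) := by
    linear_combination (norm := module) h - hleft
  exact smul_right_injective _ two_ne_zero htwo

theorem forall_expectation_twoCopyOperator_pureState_le_iff (ψ φ : StateVector d) :
    (∀ χ : StateVector d, expectation (twoCopyOperator (pureState ψ) (pureState φ)) χ.1 ≤
        expectation (twoCopyOperator (pureState ψ) (pureState φ)) ψ.1) ↔
      pureState ψ * pureState φ = 0 ∨ pureState ψ = pureState φ := by
  refine ⟨fun h => pureState_mul_eq_zero_or_eq_of_mul_eq_smul <|
    pureState_mul_eq_smul_of_twoCopyOperator_mul_eq_smul <|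
    mul_pureState_of_forall_expectation_le
      (isHermitian_twoCopyOperator (posSemidef_pureState ψ).1 (posSemidef_pureState φ).1) h, ?_⟩
  have hψ := isStarProjection_pureState ψ
  rintro (horth | heq) χ
  · have hsum := hψ.add (isStarProjection_pureState φ) horth
    have hadj : pureState φ * pureState ψ = 0 := by
      simpa only [conjTranspose_mul, (posSemidef_pureState _).1.eq, conjTranspose_zero] using
        congrArg conjTranspose horth
    have hQ : twoCopyOperator (pureState ψ) (pureState φ) =
        1 + (pureState ψ + pureState φ) := by
      rw [twoCopyOperator_pureState, horth, hadj, trace_zero, add_zero, add_zero, add_zero,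
        one_smul, add_assoc]
    have hφ := (posSemidef_iff_expectation_nonneg (posSemidef_pureState φ).1).1
      (posSemidef_pureState φ) ψ
    have hχ := expectation_le_one_of_isStarProjection hsum χ
    simp only [hQ, expectation_add, expectation_one_stateVector, expectation_pureState_self]
      at hχ ⊢
    linarith
  · have hQ : twoCopyOperator (pureState ψ) (pureState ψ) =
        (2 : ℝ) • 1 + (4 : ℝ) • pureState ψ := by
      rw [twoCopyOperator_pureState, hψ.isIdempotentElem.eq, trace_pureState]
      module
    have hχ := expectation_le_one_of_isStarProjection hψ χ
    simp only [← heq, hQ, expectation_add, expectation_smul, expectation_one_stateVector,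
      expectation_pureState_self]
    linarith

end CopyOperators

section MaxExpectation

variable {d : ℕ}

/-- The largest expectation value of `Q` in a state, that is, the largest eigenvalue of `Q` when `Q`
is Hermitian. -/
noncomputable def maxExpectation (Q : Matrix (Fin d) (Fin d) ℂ) : ℝ :=
  ⨆ ψ : StateVector d, expectation Q ψ.1

/-- A pure state as a density matrix. -/
def DensityMatrix.ofState (ψ : StateVector d) : DensityMatrix d :=
  ⟨pureState ψ, posSemidef_pureState ψ, trace_pureState ψ⟩

variable [NeZero d]

theorem isGreatest_maxExpectation (Q : Matrix (Fin d) (Fin d) ℂ) :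
    IsGreatest (Set.range fun ψ : StateVector d => expectation Q ψ.1) (maxExpectation Q) := by
  obtain ⟨ψ, hψ⟩ := exists_forall_expectation_le Q
  have h : IsGreatest (Set.range fun ψ : StateVector d => expectation Q ψ.1)
      (expectation Q ψ.1) := ⟨⟨ψ, rfl⟩, Set.forall_mem_range.2 hψ⟩
  rwa [maxExpectation, iSup, h.csSup_eq]

theorem expectation_le_maxExpectation (Q : Matrix (Fin d) (Fin d) ℂ) (ψ : StateVector d) :
    expectation Q ψ.1 ≤ maxExpectation Q :=
  (isGreatest_maxExpectation Q).2 ⟨ψ, rfl⟩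

theorem exists_expectation_eq_maxExpectation (Q : Matrix (Fin d) (Fin d) ℂ) :
    ∃ ψ : StateVector d, expectation Q ψ.1 = maxExpectation Q :=
  (isGreatest_maxExpectation Q).1

theorem expectation_eq_maxExpectation_iff {Q : Matrix (Fin d) (Fin d) ℂ} {ψ : StateVector d} :
    expectation Q ψ.1 = maxExpectation Q ↔
      ∀ χ : StateVector d, expectation Q χ.1 ≤ expectation Q ψ.1 := by
  refine ⟨fun h χ => h ▸ expectation_le_maxExpectation Q χ, fun h => ?_⟩
  obtain ⟨χ, hχ⟩ := exists_expectation_eq_maxExpectation Q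
  exact (expectation_le_maxExpectation Q ψ).antisymm (hχ ▸ h χ)

theorem re_trace_mul_le_maxExpectation {Q : Matrix (Fin d) (Fin d) ℂ} (hQ : Q.IsHermitian)
    (σ : DensityMatrix d) : (Q * σ.1).trace.re ≤ maxExpectation Q := by
  have h := re_trace_mul_nonneg
    ((posSemidef_smul_one_sub_iff hQ).2 (expectation_le_maxExpectation Q)) σ.2.1
  rw [sub_mul, smul_mul_assoc, one_mul, trace_sub, trace_smul, σ.2.2, Complex.sub_re,
    Complex.smul_re, Complex.one_re, smul_eq_mul, mul_one] at h
  exact sub_nonneg.1 h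

theorem maxExpectation_le_re_trace {A : Matrix (Fin d) (Fin d) ℂ} (hA : A.PosSemidef) :
    maxExpectation A ≤ A.trace.re := by
  obtain ⟨ψ, hψ⟩ := exists_expectation_eq_maxExpectation A
  exact hψ ▸ expectation_le_re_trace hA ψ

theorem maxExpectation_nonneg {A : Matrix (Fin d) (Fin d) ℂ} (hA : A.PosSemidef) :
    0 ≤ maxExpectation A := by
  obtain ⟨ψ, hψ⟩ := exists_expectation_eq_maxExpectation A
  exact hψ ▸ (posSemidef_iff_expectation_nonneg hA.1).1 hA ψ

theorem maxExpectation_eq_re_trace_iff {A : Matrix (Fin d) (Fin d) ℂ} (hA : A.PosSemidef) :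
    maxExpectation A = A.trace.re ↔ ∃ ψ : StateVector d, A = A.trace.re • pureState ψ := by
  simp only [← expectation_eq_re_trace_iff hA]
  constructor
  · intro h
    exact h ▸ exists_expectation_eq_maxExpectation A
  · rintro ⟨ψ, hψ⟩
    exact (maxExpectation_le_re_trace hA).antisymm (hψ ▸ expectation_le_maxExpectation A ψ)

theorem maxExpectation_oneCopyOperator (A : Matrix (Fin d) (Fin d) ℂ) :
    maxExpectation (oneCopyOperator A) = A.trace.re + maxExpectation A := by
  obtain ⟨ψ, hψ⟩ := exists_expectation_eq_maxExpectation A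
  rw [← hψ, ← expectation_oneCopyOperator, eq_comm, expectation_eq_maxExpectation_iff]
  intro χ
  rw [expectation_oneCopyOperator, expectation_oneCopyOperator, hψ]
  exact add_le_add_right (expectation_le_maxExpectation A χ) _

theorem isStarProjection_and_rank_eq_one_iff {P : Matrix (Fin d) (Fin d) ℂ} :
    IsStarProjection P ∧ P.rank = 1 ↔ ∃ ψ : StateVector d, P = pureState ψ := by
  constructor
  · rintro ⟨hP, hrank⟩
    have htrace : P.trace = 1 := by
      rw [trace_eq_rank_of_isIdempotentElem hP.isIdempotentElem, hrank, Nat.cast_one]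
    have hpos := posSemidef_of_isStarProjection hP
    have hmax : maxExpectation P = P.trace.re := by
      refine (maxExpectation_le_re_trace hpos).antisymm ?_
      have h := re_trace_mul_le_maxExpectation hpos.1 ⟨P, hpos, htrace⟩
      rwa [hP.isIdempotentElem.eq] at h
    simpa only [htrace, Complex.one_re, one_smul] using (maxExpectation_eq_re_trace_iff hpos).1 hmax
  · rintro ⟨ψ, rfl⟩
    exact ⟨isStarProjection_pureState ψ, rank_pureState ψ⟩

theorem expectation_twoCopyOperator_eq_maxExpectation_iff {a b : ℝ} (ha : 0 < a) (hb : 0 < b)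
    (ψ φ : StateVector d) :
    expectation (twoCopyOperator (a • pureState ψ) (b • pureState φ)) ψ.1 =
        maxExpectation (twoCopyOperator (a • pureState ψ) (b • pureState φ)) ↔
      pureState ψ * pureState φ = 0 ∨ pureState ψ = pureState φ := by
  rw [← forall_expectation_twoCopyOperator_pureState_le_iff, expectation_eq_maxExpectation_iff]
  simp only [twoCopyOperator_smul_smul, expectation_smul, mul_le_mul_iff_right₀ (mul_pos ha hb)]

variable {ι : Type*} {Q : ι → Matrix (Fin d) (Fin d) ℂ}

theorem summable_maxExpectation (hQ : ∀ j, (Q j).PosSemidef)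
    (hsum : Summable fun j => (Q j).trace.re) : Summable fun j => maxExpectation (Q j) :=
  .of_nonneg_of_le (fun j => maxExpectation_nonneg (hQ j))
    (fun j => maxExpectation_le_re_trace (hQ j)) hsum

theorem iSup_tsum_re_trace_mul (hQ : ∀ j, (Q j).PosSemidef)
    (hsum : Summable fun j => (Q j).trace.re) :
    ⨆ est : ι → DensityMatrix d, ∑' j, (Q j * (est j).1).trace.re =
      ∑' j, maxExpectation (Q j) := by
  choose ψ hψ using fun j => exists_expectation_eq_maxExpectation (Q j)
  have hmax := summable_maxExpectation hQ hsum
  have hle (est : ι → DensityMatrix d) (j : ι) :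
      (Q j * (est j).1).trace.re ≤ maxExpectation (Q j) :=
    re_trace_mul_le_maxExpectation (hQ j).1 (est j)
  have hsummable (est : ι → DensityMatrix d) : Summable fun j => (Q j * (est j).1).trace.re :=
    .of_nonneg_of_le (fun j => re_trace_mul_nonneg (hQ j) (est j).2.1) (hle est) hmax
  refine IsGreatest.csSup_eq ⟨⟨fun j => .ofState (ψ j), tsum_congr fun j => ?_⟩,
    Set.forall_mem_range.2 fun est => (hsummable est).tsum_le_tsum (hle est) hmax⟩
  exact (re_trace_mul_pureState _ _).trans (hψ j)

end MaxExpectation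

theorem tsum_eq_tsum_iff_of_le {ι : Type*} {f g : ι → ℝ} (hf : Summable f) (hg : Summable g)
    (hle : f ≤ g) : ∑' j, f j = ∑' j, g j ↔ f = g := by
  refine ⟨fun h => ?_, fun h => by rw [h]⟩
  by_contra hne
  obtain ⟨-, j, hj⟩ := Pi.lt_def.1 (hle.lt_of_ne hne)
  exact (hf.tsum_lt_tsum hle hj hg).ne h

namespace POVM

section OutcomeSums

variable {ι ι' κ : Type*} [Fintype κ] [DecidableEq κ]

theorem hasSum_trace (A : POVM ι κ) : HasSum (fun j => (A.elem j).trace) (Fintype.card κ) := by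
  have h := A.hasSum_one.map (traceAddMonoidHom κ ℂ) continuous_id.matrix_trace
  simpa only [Function.comp_def, traceAddMonoidHom_apply, trace_one] using h

theorem hasSum_re_trace (A : POVM ι κ) :
    HasSum (fun j => (A.elem j).trace.re) (Fintype.card κ) :=
  Complex.hasSum_re A.hasSum_trace

theorem hasSum_trace_mul_trace (A : POVM ι κ) (B : POVM ι' κ) :
    HasSum (fun p : ι × ι' => (A.elem p.1).trace * (B.elem p.2).trace) (Fintype.card κ ^ 2) := by
  simpa only [tensor, trace_kronecker, Fintype.card_prod, Nat.cast_mul, sq] using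
    (A.tensor B).hasSum_trace

theorem hasSum_trace_mul (A : POVM ι κ) (B : POVM ι' κ) :
    HasSum (fun p : ι × ι' => (A.elem p.1 * B.elem p.2).trace) (Fintype.card κ) := by
  have hswap := hasSum_sum (s := Finset.univ) fun a _ => hasSum_sum (s := Finset.univ) fun b _ =>
    Pi.hasSum.1 (Pi.hasSum.1 (A.tensor B).hasSum_one (a, b)) (b, a)
  convert hswap using 1
  · simp only [trace, diag_apply, mul_apply, tensor, kroneckerMap_apply]
  · simp [one_apply, eq_comm]

theorem summable_re_trace_twoCopyOperator {d : ℕ} (A : POVM ι (Fin d))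
    (B : POVM ι' (Fin d)) :
    Summable fun p : ι × ι' => (twoCopyOperator (A.elem p.1) (B.elem p.2)).trace.re := by
  have h := ((A.hasSum_trace_mul_trace B).add (A.hasSum_trace_mul B)).mul_left ((d : ℂ) + 2)
  refine (Complex.hasSum_re h).summable.congr fun p => congrArg Complex.re ?_
  rw [← mul_one (twoCopyOperator _ _), trace_twoCopyOperator_mul, trace_one, Fintype.card_fin,
    mul_one, mul_one, mul_one, mul_one, trace_mul_comm (B.elem p.2)]
  ring

end OutcomeSums

section Fidelities

variable {ι ι' : Type*} {d : ℕ} [NeZero d]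

theorem averageFidelity_oneCopy (A : POVM ι (Fin d)) (est : ι → DensityMatrix d) :
    A.averageFidelity (fun ρ => ρ) est =
      (∑' j, (oneCopyOperator (A.elem j) * (est j).1).trace.re) / (d * (d + 1)) := by
  rw [← tsum_div_const]
  refine tsum_congr fun j => ?_
  rw [← integral_expectation_mul (A.posSemidef j).1 (est j).2.1.1]
  simp only [trace_mul_comm (pureState _), re_trace_mul_pureState]

theorem averageFidelity_twoCopy (A : POVM ι (Fin d)) (B : POVM ι' (Fin d))
    (est : ι × ι' → DensityMatrix d) :
    (A.tensor B).averageFidelity (fun ρ => ρ ⊗ₖ ρ) est =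
      (∑' p, (twoCopyOperator (A.elem p.1) (B.elem p.2) * (est p).1).trace.re) /
        (d * (d + 1) * (d + 2)) := by
  rw [← tsum_div_const]
  refine tsum_congr fun p => ?_
  rw [← integral_expectation_mul_mul (A.posSemidef p.1).1 (B.posSemidef p.2).1 (est p).2.1.1]
  refine integral_congr_ae (.of_forall fun ψ => ?_)
  have him : (A.elem p.1 * pureState ψ).trace.im = 0 :=
    (congrArg Complex.im (trace_mul_vecMulVec_star _ _)).trans
      ((A.posSemidef p.1).1.im_star_dotProduct_mulVec_self _)
  simp only [tensor, ← mul_kronecker_mul, trace_kronecker, trace_mul_comm (pureState ψ),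
    Complex.mul_re, him, zero_mul, sub_zero, re_trace_mul_pureState]

theorem fidelityOneCopy_eq (A : POVM ι (Fin d)) :
    A.fidelityOneCopy = (d + ∑' j, maxExpectation (A.elem j)) / (d * (d + 1)) := by
  have htrace := A.hasSum_re_trace
  rw [Fintype.card_fin] at htrace
  have hsum : Summable fun j => (oneCopyOperator (A.elem j)).trace.re := by
    refine (htrace.summable.mul_left ((d : ℝ) + 1)).congr fun j => ?_
    simp only [oneCopyOperator, trace_add, trace_smul, trace_one, Fintype.card_fin, smul_eq_mul,
      Complex.add_re, Complex.mul_re, Complex.natCast_re, Complex.natCast_im]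
    ring
  have hmax := summable_maxExpectation A.posSemidef htrace.summable
  have hiSup := iSup_tsum_re_trace_mul (fun j => posSemidef_oneCopyOperator (A.posSemidef j)) hsum
  simp only [maxExpectation_oneCopyOperator, htrace.summable.tsum_add hmax, htrace.tsum_eq]
    at hiSup
  simp only [fidelityOneCopy, estimationFidelity, averageFidelity_oneCopy, div_eq_mul_inv]
  rw [← Real.iSup_mul_of_nonneg (by positivity), hiSup]

theorem fidelityTwoCopy_tensor_eq (A : POVM ι (Fin d)) (B : POVM ι' (Fin d)) :
    (A.tensor B).fidelityTwoCopy =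
      (∑' p : ι × ι', maxExpectation (twoCopyOperator (A.elem p.1) (B.elem p.2))) /
        (d * (d + 1) * (d + 2)) := by
  have hiSup := iSup_tsum_re_trace_mul
    (fun p : ι × ι' => posSemidef_twoCopyOperator (A.posSemidef p.1) (B.posSemidef p.2))
    (summable_re_trace_twoCopyOperator A B)
  simp only [fidelityTwoCopy, estimationFidelity, averageFidelity_twoCopy, div_eq_mul_inv]
  rw [← Real.iSup_mul_of_nonneg (by positivity), hiSup]

theorem fidelityOneCopy_eq_iff (A : POVM ι (Fin d)) :
    A.fidelityOneCopy = 2 / (d + 1) ↔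
      ∃ ψ : ι → StateVector d, ∀ j, A.elem j = (A.elem j).trace.re • pureState (ψ j) := by
  have hd : (0 : ℝ) < d := Nat.cast_pos.2 (NeZero.pos d)
  have htrace := A.hasSum_re_trace
  rw [Fintype.card_fin] at htrace
  have hiff : A.fidelityOneCopy = 2 / (d + 1) ↔
      ∑' j, maxExpectation (A.elem j) = ∑' j, (A.elem j).trace.re := by
    rw [fidelityOneCopy_eq, htrace.tsum_eq, div_eq_div_iff (by positivity) (by positivity)]
    constructor <;> intro h
    · nlinarith
    · rw [h]; ring
  rw [hiff, tsum_eq_tsum_iff_of_le (summable_maxExpectation A.posSemidef htrace.summable)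
    htrace.summable fun j => maxExpectation_le_re_trace (A.posSemidef j), funext_iff]
  simp only [maxExpectation_eq_re_trace_iff (A.posSemidef _), Classical.skolem]

theorem fidelityTwoCopy_tensor_eq_iff {A : POVM ι (Fin d)} (B : POVM ι' (Fin d))
    {ψ : ι → StateVector d} (hA : ∀ j, A.elem j = (A.elem j).trace.re • pureState (ψ j)) :
    (A.tensor B).fidelityTwoCopy = 2 / (d + 1) ↔ ∀ j k,
      expectation (twoCopyOperator (A.elem j) (B.elem k)) (ψ j).1 =
        maxExpectation (twoCopyOperator (A.elem j) (B.elem k)) := by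
  have hd : (0 : ℝ) < d := Nat.cast_pos.2 (NeZero.pos d)
  have hsum : HasSum (fun p : ι × ι' =>
      expectation (twoCopyOperator (A.elem p.1) (B.elem p.2)) (ψ p.1).1) (2 * d ^ 2 + 4 * d) := by
    have h := Complex.hasSum_re (((A.hasSum_trace_mul_trace B).mul_left 2).add
      ((A.hasSum_trace_mul B).mul_left 4))
    simp only [← expectation_twoCopyOperator_of_eq_smul_pureState (hA _), Fintype.card_fin] at h
    exact_mod_cast h
  have hiff : (A.tensor B).fidelityTwoCopy = 2 / (d + 1) ↔
      ∑' p : ι × ι', expectation (twoCopyOperator (A.elem p.1) (B.elem p.2)) (ψ p.1).1 =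
        ∑' p : ι × ι', maxExpectation (twoCopyOperator (A.elem p.1) (B.elem p.2)) := by
    rw [fidelityTwoCopy_tensor_eq, hsum.tsum_eq, eq_comm (a := 2 * _ + _),
      div_eq_iff (by positivity)]
    field_simp
    ring_nf
  rw [hiff, tsum_eq_tsum_iff_of_le hsum.summable
    (summable_maxExpectation (fun p => posSemidef_twoCopyOperator (A.posSemidef _) (B.posSemidef _))
      (summable_re_trace_twoCopyOperator A B)) fun p => expectation_le_maxExpectation _ _,
    funext_iff, Prod.forall]

end Fidelities

section RankOneProjective

variable {ι : Type*} {d : ℕ} {A : POVM ι (Fin d)}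

theorem IsSimple.elem_ne_zero [NeZero d] (hA : A.IsSimple) (j : ι) : A.elem j ≠ 0 := by
  by_cases! h : ∃ k, k ≠ j
  · obtain ⟨k, hk⟩ := h
    exact (hA hk.symm).ne_zero 0
  · have hone := (hasSum_single j fun k hk => absurd (h k) hk).unique A.hasSum_one
    rw [hone]
    exact one_ne_zero

theorem isStarProjection_elem (hA : Pairwise fun j k => A.elem j * A.elem k = 0) (j : ι) :
    IsStarProjection (A.elem j) where
  isIdempotentElem := by
    have h := A.hasSum_one.mul_left (A.elem j)
    rw [mul_one] at h
    exact (hasSum_single j fun k hk => hA hk.symm).unique h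
  isSelfAdjoint := (A.posSemidef j).1

theorem isRankOneProjective_iff [NeZero d] (hzero : ∀ j, A.elem j ≠ 0) :
    A.IsRankOneProjective ↔
      (∃ ψ : ι → StateVector d, ∀ j, A.elem j = (A.elem j).trace.re • pureState (ψ j)) ∧
        Pairwise fun j k => A.elem j * A.elem k = 0 := by
  refine and_congr_left fun horth => ?_
  rw [← Classical.skolem (p := fun j ψ => A.elem j = (A.elem j).trace.re • pureState ψ)]
  refine forall_congr' fun j => ⟨fun h => ?_, fun ⟨ψ, hψ⟩ => ?_⟩
  · obtain ⟨ψ, hψ⟩ := isStarProjection_and_rank_eq_one_iff.1 h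
    exact ⟨ψ, by rw [hψ, trace_pureState, Complex.one_re, one_smul]⟩
  · have hsq := (isStarProjection_elem horth j).isIdempotentElem
    have hone := eq_one_of_isIdempotentElem_smul_pureState (hψ ▸ hsq) (hψ ▸ hzero j)
    exact isStarProjection_and_rank_eq_one_iff.2 ⟨ψ, by rw [hψ, hone, one_smul]⟩

theorem IsSimple.pureState_ne (hA : A.IsSimple) {ψ : ι → StateVector d} {a : ι → ℝ}
    (hψ : ∀ j, A.elem j = a j • pureState (ψ j)) {j k : ι} (hjk : j ≠ k) :
    pureState (ψ j) ≠ pureState (ψ k) := by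
  intro heq
  have hdep : (a k : ℂ) • A.elem j + (-a j : ℂ) • A.elem k = 0 := by
    rw [hψ j, hψ k, heq]
    module
  have hak := (LinearIndependent.pair_iff.1 (hA hjk) _ _ hdep).1
  refine (hA hjk).ne_zero 1 ?_
  change A.elem k = 0
  rw [hψ k, Complex.ofReal_eq_zero.1 hak, zero_smul]

theorem IsSimple.fidelityTwoCopy_eq_iff [NeZero d] (hA : A.IsSimple) {ψ : ι → StateVector d}
    (hψ : ∀ j, A.elem j = (A.elem j).trace.re • pureState (ψ j)) :
    (A.tensor A).fidelityTwoCopy = 2 / (d + 1) ↔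
      Pairwise fun j k => A.elem j * A.elem k = 0 := by
  have hpos (j : ι) : 0 < (A.elem j).trace.re :=
    (re_trace_nonneg (A.posSemidef j)).lt_of_ne' fun h =>
      hA.elem_ne_zero j (by rw [hψ j, h, zero_smul])
  rw [fidelityTwoCopy_tensor_eq_iff A hψ]
  refine forall₂_congr fun j k => ?_
  have hmul : A.elem j * A.elem k = 0 ↔ pureState (ψ j) * pureState (ψ k) = 0 := by
    rw [hψ j, hψ k, smul_mul_smul_comm, smul_eq_zero_iff_right (mul_pos (hpos j) (hpos k)).ne']
  change _ ↔ (j ≠ k → A.elem j * A.elem k = 0)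
  rw [hmul, hψ j, hψ k, expectation_twoCopyOperator_eq_maxExpectation_iff (hpos j) (hpos k)]
  rcases eq_or_ne j k with rfl | hjk
  · simp only [or_true, ne_eq, not_true_eq_false, false_imp_iff]
  · simp only [hA.pureState_ne hψ hjk, or_false, hjk, ne_eq, not_false_eq_true, true_imp_iff]

end RankOneProjective

end POVM

theorem corollary1 {d : ℕ} (hd : 1 ≤ d) {ι : Type*} (A : POVM ι (Fin d)) (hA : A.IsSimple) :
    A.IsRankOneProjective ↔
      (A.tensor A).fidelityTwoCopy = A.fidelityOneCopy ∧
        A.fidelityOneCopy = 2 / ((d : ℝ) + 1) := by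
  have : NeZero d := ⟨Nat.one_le_iff_ne_zero.1 hd⟩
  rw [POVM.isRankOneProjective_iff hA.elem_ne_zero, ← POVM.fidelityOneCopy_eq_iff,
    and_comm (b := A.fidelityOneCopy = _)]
  refine and_congr_right fun hone => ?_
  obtain ⟨ψ, hψ⟩ := A.fidelityOneCopy_eq_iff.1 hone
  rw [hone, hA.fidelityTwoCopy_eq_iff hψ]
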